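/- **Proposition.** Let $d\ge 1$, $L\in\mathbb N$, $\sigma_0,\sigma,\lambda_1,\lambda_2>0$, $\boldsymbol y\in\mathbb R^L$, and let $x_1,\dots,x_L\in\mathbb R^d$ be sampling points (for instance a uniform grid of $L=K^d$ pixels in $[0,1]^d$). Write $$g(x)=\frac{1}{(\sqrt{2\pi\sigma^2})^d}\exp\Big(-\frac{\|x\|^2}{2\sigma^2}\Big),\qquad k(x,y)=\frac{1}{(\sqrt{2\pi\sigma_0^2})^d}\exp\Big(-\frac{\|y-x\|^2}{2\sigma_0^2}\Big),\qquad x,y\in\mathbb R^d .$$ Let $\mathcal M(\mathbb R^d)$ be the space of finite signed Radon measures on $\mathbb R^d$ with the total-variation norm $\|m\|_{\mathcal M}=\sup\{\int\varphi\,\mathrm dm:\varphi\in C_0(\mathbb R^d),\ \|\varphi\|_\infty=1\}$, where $C_0(\mathbb R^d)$ is the space of continuous real functions vanishing at infinity, and let $\mathcal H$ be the reproducing kernel Hilbert space of real functions on $\mathbb R^d$ with kernel $k$. Define $\Phi_{\mathcal B}:\mathcal M(\mathbb R^d)\to\mathbb R^L$ and $\Phi_{\mathcal H}:\mathcal H\to\mathbb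 R^L$ by $$[\Phi_{\mathcal B}(s_1)]_\ell=\int_{\mathbb R^d} g(x_\ell-x)\,\mathrm ds_1(x),\qquad [\Phi_{\mathcal H}(s_2)]_\ell=\int_{\mathbb R^d} g(x_\ell-x)\,s_2(x)\,\mathrm dx .$$ The operator $\Phi_{\mathcal H}$ is linear and bounded; let $\Phi_{\mathcal H}^*$ be its adjoint, let $\phi_\ell\in\mathcal H$ be the Riesz representer of $s_2\mapsto[\Phi_{\mathcal H}(s_2)]_\ell$, and put $$\mathbf M_{\lambda_2}=\frac1{\lambda_2}\big(\Phi_{\mathcal H}\Phi_{\mathcal H}^*+\lambda_2\mathbf I_L\big)=\frac1{\lambda_2}\big(\langle\phi_k,\phi_\ell\rangle_{\mathcal H}+\lambda_2\delta[k-\ell]\big)_{1\le k,\ell\le L}\in\mathbb R^{L\times L}.$$ Let $\mathcal W$ be the set of minimizers over $(s_1,s_2)\in\mathcal M(\mathbb R^d)\times\mathcal H$ of $$\frac12\big\|\boldsymbol y-(\Phi_{\mathcal B}(s_1)+\Phi_{\mathcal H}(s_2))\big\|_2^2+\lambda_1\|s_1\|_{\mathcal M}+\frac{\lambda_2}2\|s_2\|_{\mathcal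 H}^2 .$$ Then $\mathcal W$ is non-empty, convex, and compact for the weak* topology of $\mathcal M(\mathbb R^d)\times\mathcal H$, that is, the coarsest topology for which $(s_1,s_2)\mapsto\int\varphi\,\mathrm ds_1$ and $(s_1,s_2)\mapsto\langle h,s_2\rangle_{\mathcal H}$ are continuous for all $\varphi\in C_0(\mathbb R^d)$ and $h\in\mathcal H$. Moreover there is a vector $\boldsymbol w\in\mathbb R^L$ such that $\Phi_{\mathcal B}(s_1)=\boldsymbol w$ for every $(s_1,s_2)\in\mathcal W$, and every extreme point $(s_1^*,s_2^*)$ of $\mathcal W$ has the form $$s_1^*=\sum_{k=1}^{K_0}a_k\delta_{z_k},\qquad s_2^*=\frac1{\lambda_2}\Phi_{\mathcal H}^*\,\mathbf M_{\lambda_2}^{-1}(\boldsymbol y-\boldsymbol w),$$ with $0\le K_0\le L$, $a_k\in\mathbb R$ and $z_k\in\mathbb R^d$. -/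

import Mathlib

open MeasureTheory ProbabilityTheory Set
open scoped ZeroAtInfty InnerProductSpace

noncomputable section

namespace SparseSmooth

/-- The isotropic Gaussian density of standard deviation `σ` on `ℝ^d`,
`x ↦ (√(2πσ²))^{-d} exp (-‖x‖² / (2σ²))`, with the Euclidean norm. -/
def gaussianDensity (d : ℕ) (σ : ℝ) (x : EuclideanSpace ℝ (Fin d)) : ℝ :=
  1 / (Real.sqrt (2 * Real.pi * σ ^ 2)) ^ d * Real.exp (-‖x‖ ^ 2 / (2 * σ ^ 2))

/-! ### The Gaussian reproducing kernel Hilbert space -/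

/-- The Gaussian kernel `k(x, y) = g₀(‖y - x‖)`; the real number `k(x, y)` is written as the
operator `ℝ → ℝ` of multiplication by it, as Mathlib's theory of reproducing kernels requires. -/
def gaussianKernel (d : ℕ) (σ₀ : ℝ) :
    Matrix (EuclideanSpace ℝ (Fin d)) (EuclideanSpace ℝ (Fin d)) (ℝ →L[ℝ] ℝ) :=
  Matrix.of fun x y => gaussianDensity d σ₀ (y - x) • ContinuousLinearMap.id ℝ ℝ

lemma gaussianDensity_neg (d : ℕ) (σ : ℝ) (x : EuclideanSpace ℝ (Fin d)) :
    gaussianDensity d σ (-x) = gaussianDensity d σ x := by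
  simp [gaussianDensity]

lemma continuous_gaussianDensity (d : ℕ) (σ : ℝ) : Continuous (gaussianDensity d σ) := by
  unfold gaussianDensity
  fun_prop

/-- The Gaussian is the expectation of `cos` of a standard Gaussian linear form. -/
lemma gaussianDensity_eq_integral (d : ℕ) (σ : ℝ) (x : EuclideanSpace ℝ (Fin d)) :
    gaussianDensity d σ x = 1 / (Real.sqrt (2 * Real.pi * σ ^ 2)) ^ d *
      ∫ t, Real.cos ⟪t, σ⁻¹ • x⟫_ℝ ∂(stdGaussian (EuclideanSpace ℝ (Fin d))) := by
  have h := congrArg Complex.re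
    (charFun_stdGaussian (E := EuclideanSpace ℝ (Fin d)) (σ⁻¹ • x))
  rw [charFun_apply, ← RCLike.re_eq_complex_re, ← integral_re] at h
  · have e : ∀ t : EuclideanSpace ℝ (Fin d),
        RCLike.re (Complex.exp (((⟪t, σ⁻¹ • x⟫_ℝ : ℝ) : ℂ) * Complex.I)) =
          Real.cos ⟪t, σ⁻¹ • x⟫_ℝ := fun t => by
      rw [RCLike.re_eq_complex_re, Complex.exp_ofReal_mul_I_re]
    simp_rw [e] at h
    rw [h]
    have e2 : (-((‖σ⁻¹ • x‖ : ℝ) : ℂ) ^ 2 / 2) = ((-‖σ⁻¹ • x‖ ^ 2 / 2 : ℝ) : ℂ) := by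
      push_cast; ring
    rw [e2, RCLike.re_eq_complex_re, Complex.exp_ofReal_re, gaussianDensity]
    congr 2
    rw [norm_smul, mul_pow, norm_inv, inv_pow, Real.norm_eq_abs, sq_abs]
    by_cases hσ : σ = 0
    · simp [hσ]
    · field_simp
  · refine Integrable.of_bound (C := 1) (by fun_prop) (Filter.Eventually.of_forall fun t => ?_)
    rw [Complex.norm_exp_ofReal_mul_I]

/-- The Gaussian kernel is positive semidefinite. -/
theorem posSemidef_gaussianKernel (d : ℕ) (σ₀ : ℝ) : (gaussianKernel d σ₀).PosSemidef := by
  have tfae := (RKHS.posSemidef_tfae (K := gaussianKernel d σ₀)).out 0 2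
  rw [tfae]
  refine ⟨?_, fun v => ?_⟩
  · ext x y
    simp [gaussianKernel, ContinuousLinearMap.star_eq_adjoint, ContinuousLinearMap.adjoint_id, ← gaussianDensity_neg d σ₀ (x - y)]
  · have hint : ∀ z : EuclideanSpace ℝ (Fin d), Integrable (fun t => Real.cos ⟪t, z⟫_ℝ)
        (stdGaussian (EuclideanSpace ℝ (Fin d))) := fun z =>
      Integrable.of_bound (C := 1) (by fun_prop)
        (Filter.Eventually.of_forall fun t => Real.abs_cos_le_one _)
    have key : 0 ≤ ∫ t, ∑ x ∈ v.support, ∑ x' ∈ v.support,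
        v x * v x' * Real.cos ⟪t, σ₀⁻¹ • (x - x')⟫_ℝ
          ∂(stdGaussian (EuclideanSpace ℝ (Fin d))) := by
      refine integral_nonneg fun t => ?_
      have : ∑ x ∈ v.support, ∑ x' ∈ v.support,
          v x * v x' * Real.cos ⟪t, σ₀⁻¹ • (x - x')⟫_ℝ =
          (∑ x ∈ v.support, v x * Real.cos ⟪t, σ₀⁻¹ • x⟫_ℝ) ^ 2 +
          (∑ x ∈ v.support, v x * Real.sin ⟪t, σ₀⁻¹ • x⟫_ℝ) ^ 2 := by
        simp only [sq, Finset.sum_mul_sum, ← Finset.sum_add_distrib, smul_sub, inner_sub_right,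
          Real.cos_sub]
        refine Finset.sum_congr rfl fun _ _ => Finset.sum_congr rfl fun _ _ => ?_
        ring
      simp only [Pi.zero_apply]
      rw [this]
      positivity
    rw [integral_finsetSum _ fun x _ => integrable_finsetSum _ fun x' _ =>
      (hint _).const_mul _] at key
    simp_rw [integral_finsetSum _ fun x' _ => (hint _).const_mul _, integral_const_mul] at key
    have hc : 0 ≤ 1 / (Real.sqrt (2 * Real.pi * σ₀ ^ 2)) ^ d := by positivity
    have := mul_nonneg hc key
    simp only [Finsupp.sum, gaussianKernel, Matrix.of_apply, RCLike.re_to_real]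
    refine le_of_le_of_eq this (Eq.symm ?_)
    rw [Finset.mul_sum]
    refine Finset.sum_congr rfl fun x _ => ?_
    rw [Finset.mul_sum]
    refine Finset.sum_congr rfl fun x' _ => ?_
    rw [gaussianDensity_eq_integral]
    simp
    ring

instance (d : ℕ) (σ₀ : ℝ) : Fact (gaussianKernel d σ₀).PosSemidef :=
  ⟨posSemidef_gaussianKernel d σ₀⟩

/-- The reproducing kernel Hilbert space of the Gaussian kernel (Moore–Aronszajn construction):
a Hilbert space of functions `ℝ^d → ℝ` whose reproducing kernel is `gaussianKernel d σ₀`. -/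
abbrev GaussianRKHS (d : ℕ) (σ₀ : ℝ) : Type := RKHS.OfKernel (gaussianKernel d σ₀)

lemma norm_apply_le (d : ℕ) (σ₀ : ℝ) (f : GaussianRKHS d σ₀) (x : EuclideanSpace ℝ (Fin d)) :
    ‖f x‖ ≤ ‖f‖ * √‖gaussianDensity d σ₀ 0‖ := by
  have h := RKHS.norm_apply_le f x
  rw [RKHS.OfKernel.kernel_ofKernel] at h
  simpa [gaussianKernel, norm_smul] using h

/-- Functions of the Gaussian reproducing kernel Hilbert space are continuous. -/
lemma continuous_coe (d : ℕ) (σ₀ : ℝ) (f : GaussianRKHS d σ₀) : Continuous f := by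
  have hk : ∀ x y : EuclideanSpace ℝ (Fin d),
      ⟪RKHS.kerFun (GaussianRKHS d σ₀) x 1, RKHS.kerFun (GaussianRKHS d σ₀) y 1⟫_ℝ =
        gaussianDensity d σ₀ (x - y) := fun x y => by
    rw [← RKHS.kernel_inner, RKHS.OfKernel.kernel_ofKernel]
    simp [gaussianKernel]
  have hc : Continuous fun x => RKHS.kerFun (GaussianRKHS d σ₀) x (1 : ℝ) := by
    rw [continuous_iff_continuousAt]
    intro x
    rw [ContinuousAt, tendsto_iff_norm_sub_tendsto_zero]
    have hn : ∀ y, ‖RKHS.kerFun (GaussianRKHS d σ₀) y (1 : ℝ) -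
        RKHS.kerFun (GaussianRKHS d σ₀) x 1‖ =
        √(2 * gaussianDensity d σ₀ 0 - 2 * gaussianDensity d σ₀ (y - x)) := fun y => by
      rw [← Real.sqrt_sq (norm_nonneg _), @norm_sub_sq_real, ← real_inner_self_eq_norm_sq,
        ← real_inner_self_eq_norm_sq, hk, hk, hk]
      simp only [sub_self]
      ring_nf
    simp_rw [hn]
    have : Continuous fun y =>
        √(2 * gaussianDensity d σ₀ 0 - 2 * gaussianDensity d σ₀ (y - x)) := by
      have := continuous_gaussianDensity d σ₀
      fun_prop
    simpa using this.tendsto x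
  have : (f : EuclideanSpace ℝ (Fin d) → ℝ) =
      fun x => ⟪f, RKHS.kerFun (GaussianRKHS d σ₀) x (1 : ℝ)⟫_ℝ := by
    funext x
    simp
  rw [this]
  fun_prop

lemma integrable_gaussianDensity (d : ℕ) (σ : ℝ) : Integrable (gaussianDensity d σ) := by
  by_cases hσ : σ = 0
  · subst hσ
    rcases Nat.eq_zero_or_pos d with rfl | hd
    · exact (continuous_gaussianDensity 0 0).integrable_of_hasCompactSupport
        (HasCompactSupport.of_compactSpace _)
    · have : gaussianDensity d 0 = fun _ => 0 := by
        funext x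
        simp [gaussianDensity, hd.ne']
      rw [this]
      exact integrable_zero _ _ _
  · have hb : 0 < ((1 / (2 * σ ^ 2) : ℝ) : ℂ).re := by
      rw [Complex.ofReal_re]; positivity
    have h := (GaussianFourier.integrable_cexp_neg_mul_sq_norm_add
      (V := EuclideanSpace ℝ (Fin d)) hb 0 0).norm
    unfold gaussianDensity
    refine Integrable.const_mul (h.congr (Filter.Eventually.of_forall fun x => ?_)) _
    simp only [Complex.norm_exp]
    congr 1
    rw [zero_mul, add_zero, ← Complex.ofReal_pow, ← Complex.ofReal_neg, ← Complex.ofReal_mul,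
      Complex.ofReal_re]
    ring

lemma integrable_convolution (d : ℕ) (σ₀ σ : ℝ) (u : EuclideanSpace ℝ (Fin d))
    (f : GaussianRKHS d σ₀) : Integrable fun t => gaussianDensity d σ (u - t) * f t :=
  ((integrable_gaussianDensity d σ).comp_sub_left u).mul_bdd
    (c := ‖f‖ * √‖gaussianDensity d σ₀ 0‖) (continuous_coe d σ₀ f).aestronglyMeasurable
    (Filter.Eventually.of_forall fun t => norm_apply_le d σ₀ f t)

/-- The bounded linear functional `f ↦ (g * f)(u) = ∫ g(u - t) f(t) dt` on the Gaussian
reproducing kernel Hilbert space, `g` being the Gaussian of standard deviation `σ`. -/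
def convEval (d : ℕ) (σ₀ σ : ℝ) (u : EuclideanSpace ℝ (Fin d)) : GaussianRKHS d σ₀ →L[ℝ] ℝ :=
  LinearMap.mkContinuous
    { toFun := fun f => ∫ t, gaussianDensity d σ (u - t) * f t
      map_add' := fun f h => by
        rw [← integral_add (integrable_convolution d σ₀ σ u f)
          (integrable_convolution d σ₀ σ u h)]
        simp [mul_add]
      map_smul' := fun c f => by
        rw [RingHom.id_apply, smul_eq_mul, ← integral_const_mul]
        simp [mul_left_comm] }
    ((∫ t, ‖gaussianDensity d σ (u - t)‖) * √‖gaussianDensity d σ₀ 0‖)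
    fun f => by
      refine (norm_integral_le_integral_norm _).trans ?_
      rw [mul_assoc, ← integral_mul_const]
      refine integral_mono (integrable_convolution d σ₀ σ u f).norm
        (((integrable_gaussianDensity d σ).comp_sub_left u).norm.mul_const _) fun t => ?_
      simp only [norm_mul]
      have := norm_apply_le d σ₀ f t
      gcongr
      linarith

/-! ### Measures, their total-variation norm and the weak* topology -/

/-- `M(ℝ^d)`: the finite signed Borel measures on `ℝ^d` (all of them are Radon measures). -/
abbrev RadonMeasure (d : ℕ) : Type := SignedMeasure (EuclideanSpace ℝ (Fin d))

/-- The total-variation norm `‖m‖ = sup {∫ φ dm | φ ∈ C₀(ℝ^d), ‖φ‖_∞ = 1}`. -/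
def tvNorm {d : ℕ} (m : RadonMeasure d) : ℝ :=
  sSup {r : ℝ | ∃ φ : C₀(EuclideanSpace ℝ (Fin d), ℝ), ‖φ‖ = 1 ∧ r = ∫ᵛ t, φ t ∂<•m}

/-- The Dirac mass `δ_z`. -/
def diracMass {d : ℕ} (z : EuclideanSpace ℝ (Fin d)) : RadonMeasure d :=
  (Measure.dirac z).toSignedMeasure

/-- The weak* topology of `M(ℝ^d) × H`, seen as the dual of `C₀(ℝ^d) × H` where the Hilbert space
`H` is its own dual: the coarsest topology making `(m, f) ↦ ∫ φ dm` and `(m, f) ↦ ⟪h, f⟫`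
continuous for all `φ ∈ C₀(ℝ^d)` and all `h ∈ H`. -/
abbrev weakStarTopology (d : ℕ) (H : Type) [NormedAddCommGroup H] [InnerProductSpace ℝ H] :
    TopologicalSpace (RadonMeasure d × H) :=
  TopologicalSpace.induced
    (fun p => ((fun φ : C₀(EuclideanSpace ℝ (Fin d), ℝ) => ∫ᵛ t, φ t ∂<•p.1),
      (fun h : H => ⟪h, p.2⟫_ℝ)))
    inferInstance

/-- Compactness of a subset of `M(ℝ^d) × H` for the weak* topology. -/
def IsWeakStarCompact {d : ℕ} {H : Type} [NormedAddCommGroup H] [InnerProductSpace ℝ H]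
    (S : Set (RadonMeasure d × H)) : Prop :=
  @IsCompact (RadonMeasure d × H) (weakStarTopology d H) S

/-! ### The composite deconvolution problem -/

section Problem

variable {d L : ℕ} (σ₀ σ : ℝ) (x : Fin L → EuclideanSpace ℝ (Fin d))

/-- `Φ_B(m) = ((g * m)(x_ℓ))_ℓ`, where `(g * m)(u) = ∫ g(u - t) dm(t)`. -/
def measB (m : RadonMeasure d) : EuclideanSpace ℝ (Fin L) :=
  WithLp.toLp 2 fun l => ∫ᵛ t, gaussianDensity d σ (x l - t) ∂<•m

/-- `Φ_H(f) = ((g * f)(x_ℓ))_ℓ`, where `(g * f)(u) = ∫ g(u - t) f(t) dt`. -/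
def measH : GaussianRKHS d σ₀ →L[ℝ] EuclideanSpace ℝ (Fin L) :=
  (EuclideanSpace.equiv (Fin L) ℝ).symm.toContinuousLinearMap ∘L
    ContinuousLinearMap.pi fun l => convEval d σ₀ σ (x l)

/-- The Riesz representer `φ_ℓ ∈ H` of the measurement `f ↦ (g * f)(x_ℓ)`. -/
def representer (l : Fin L) : GaussianRKHS d σ₀ :=
  (InnerProductSpace.toDual ℝ (GaussianRKHS d σ₀)).symm (convEval d σ₀ σ (x l))

/-- `M = (1/λ₂) (Φ_H Φ_H* + λ₂ I) = (1/λ₂) (⟨φ_k, φ_ℓ⟩ + λ₂ δ[k - ℓ])_{k,ℓ}`. -/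
def matM (lam₂ : ℝ) : Matrix (Fin L) (Fin L) ℝ :=
  (1 / lam₂) • (Matrix.of (fun k l => ⟪representer σ₀ σ x k, representer σ₀ σ x l⟫_ℝ) +
    lam₂ • (1 : Matrix (Fin L) (Fin L) ℝ))

/-- The objective
`½ ‖y - (Φ_B(s₁) + Φ_H(s₂))‖₂² + λ₁ ‖s₁‖_M + (λ₂/2) ‖s₂‖_H²`. -/
def objective (lam₁ lam₂ : ℝ) (y : EuclideanSpace ℝ (Fin L))
    (s : RadonMeasure d × GaussianRKHS d σ₀) : ℝ :=
  1 / 2 * ‖y - (measB σ x s.1 + measH σ₀ σ x s.2)‖ ^ 2 + lam₁ * tvNorm s.1 +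
    lam₂ / 2 * ‖s.2‖ ^ 2

/-- The set of global minimizers of the objective over `M(ℝ^d) × H`. -/
def solutionSet (lam₁ lam₂ : ℝ) (y : EuclideanSpace ℝ (Fin L)) :
    Set (RadonMeasure d × GaussianRKHS d σ₀) :=
  {s | ∀ s', objective σ₀ σ x lam₁ lam₂ y s ≤ objective σ₀ σ x lam₁ lam₂ y s'}

end Problem

end SparseSmooth

end

/-! Existence and compactness come from the direct method. M(ℝ^d) is the dual of C₀ and H is its own
dual, so products of balls are weak* compact (`isWeakStarCompact_ball_prod`). The data term is weak*
continuous, because each measurement pairs the unknowns with elements of C₀ and H; the penalties are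
lower semicontinuous and coercive. The solution set is a closed sublevel set inside such a product.

The objective is convex, strictly so in the total measurement and in s₂
(`objective_convexCombination_le`). Two minimizers therefore share both, hence also Φ_B(s₁) = w.
Stationarity in s₂ gives λ₂ s₂ = Φ_H* r with r the residual; applying Φ_H yields M r = y - w, and M
is positive definite, whence the formula for s₂.

Sparsity is a dimension count (`not_exists_disjoint_of_mem_extremePoints`). If |s₁| charged L + 1
disjoint sets, the measurements of the restrictions of s₁ to them would be dependent in ℝ^L. A
dependence with coefficients in [-1, 1] gives τ ≠ 0 with Φ_B(τ) = 0 and ‖s₁ ± τ‖ ≤ ‖s₁‖ ± D.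
Minimality forces D = 0, so both s₁ ± τ are optimal with midpoint s₁, against extremality. Hence
|s₁| has at most L support points. Localising the norm to sets rests on `tvNorm_eq_variation`. -/

noncomputable section

namespace SparseSmooth

open Filter Topology

/-! ### The dual norm and the variation measure -/

section TotalVariation

variable {d : ℕ}

instance isFiniteMeasure_variation (m : RadonMeasure d) : IsFiniteMeasure m.variation := by
  rw [← SignedMeasure.totalVariation_eq_variation, SignedMeasure.totalVariation]
  infer_instance

lemma integrable_zeroAtInfty (φ : C₀(EuclideanSpace ℝ (Fin d), ℝ))
    (μ : Measure (EuclideanSpace ℝ (Fin d))) [IsFiniteMeasure μ] : Integrable φ μ :=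
  Integrable.of_bound (C := ‖φ‖) φ.continuous.aestronglyMeasurable
    (Eventually.of_forall fun t => φ.toBCF.norm_coe_le_norm t)

lemma abs_integral_le (m : RadonMeasure d) (f : EuclideanSpace ℝ (Fin d) → ℝ) :
    |∫ᵛ t, f t ∂<•m| ≤ ∫ t, |f t| ∂m.variation := by
  have h := VectorMeasure.norm_integral_le_integral_norm (μ := m) (f := f)
    (B := (ContinuousLinearMap.lsmul ℝ ℝ (E := ℝ)).flip)
  have hB : ‖(ContinuousLinearMap.lsmul ℝ ℝ (E := ℝ)).flip‖ ≤ 1 := by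
    rw [ContinuousLinearMap.opNorm_flip]
    exact ContinuousLinearMap.opNorm_lsmul_le
  refine h.trans ((mul_le_mul_of_nonneg_right hB (integral_nonneg fun _ => norm_nonneg _)).trans ?_)
  simp

lemma abs_integral_le_variation (m : RadonMeasure d) (φ : C₀(EuclideanSpace ℝ (Fin d), ℝ)) :
    |∫ᵛ t, φ t ∂<•m| ≤ m.variation.real univ * ‖φ‖ := by
  refine (abs_integral_le m φ).trans ?_
  have : ∫ t, |φ t| ∂m.variation ≤ ∫ _, ‖φ‖ ∂m.variation :=
    integral_mono (integrable_zeroAtInfty φ _).abs (integrable_const _)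
      fun t => φ.toBCF.norm_coe_le_norm t
  simpa using this

/-- Needed before any use of `tvNorm` as a supremum: the real `sSup` of an unbounded set is 0. -/
lemma bddAbove_tvNorm (m : RadonMeasure d) :
    BddAbove {r : ℝ | ∃ φ : C₀(EuclideanSpace ℝ (Fin d), ℝ), ‖φ‖ = 1 ∧ r = ∫ᵛ t, φ t ∂<•m} := by
  refine ⟨m.variation.real univ, ?_⟩
  rintro _ ⟨φ, hφ, rfl⟩
  simpa [hφ] using (le_abs_self _).trans (abs_integral_le_variation m φ)

lemma integral_smul_zeroAtInfty (m : RadonMeasure d) (c : ℝ)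
    (φ : C₀(EuclideanSpace ℝ (Fin d), ℝ)) :
    ∫ᵛ t, (c • φ) t ∂<•m = c * ∫ᵛ t, φ t ∂<•m :=
  VectorMeasure.integral_smul φ m _ c

lemma integral_le_tvNorm_mul_norm (m : RadonMeasure d) (φ : C₀(EuclideanSpace ℝ (Fin d), ℝ)) :
    ∫ᵛ t, φ t ∂<•m ≤ tvNorm m * ‖φ‖ := by
  rcases eq_or_ne φ 0 with rfl | hφ
  · simp
  have hn : ‖φ‖ ≠ 0 := norm_ne_zero_iff.2 hφ
  have h := le_csSup (bddAbove_tvNorm m) ⟨‖φ‖⁻¹ • φ, by simp [norm_smul, hn], rfl⟩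
  rw [integral_smul_zeroAtInfty] at h
  change _ ≤ tvNorm m at h
  rwa [inv_mul_le_iff₀ (by positivity), mul_comm] at h

lemma abs_integral_le_tvNorm_mul_norm (m : RadonMeasure d)
    (φ : C₀(EuclideanSpace ℝ (Fin d), ℝ)) : |∫ᵛ t, φ t ∂<•m| ≤ tvNorm m * ‖φ‖ := by
  refine abs_le'.2 ⟨integral_le_tvNorm_mul_norm m φ, ?_⟩
  have h := integral_le_tvNorm_mul_norm m ((-1 : ℝ) • φ)
  rw [integral_smul_zeroAtInfty, norm_smul] at h
  simpa using h

lemma tvNorm_nonneg (m : RadonMeasure d) : 0 ≤ tvNorm m := by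
  by_cases h : ∃ φ : C₀(EuclideanSpace ℝ (Fin d), ℝ), ‖φ‖ = 1
  · obtain ⟨φ, hφ⟩ := h
    simpa [hφ] using (abs_nonneg _).trans (abs_integral_le_tvNorm_mul_norm m φ)
  · refine Real.sSup_nonneg ?_
    rintro _ ⟨φ, hφ, -⟩
    exact (h ⟨φ, hφ⟩).elim

lemma tvNorm_le_of_forall_le (m : RadonMeasure d) {C : ℝ} (hC : 0 ≤ C)
    (h : ∀ φ : C₀(EuclideanSpace ℝ (Fin d), ℝ), ∫ᵛ t, φ t ∂<•m ≤ C * ‖φ‖) : tvNorm m ≤ C := by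
  refine Real.sSup_le ?_ hC
  rintro _ ⟨φ, hφ, rfl⟩
  simpa [hφ] using h φ

/-- The witness is a Hahn set: m is nonnegative on i and nonpositive on its complement. -/
lemma exists_variation_eq_sub (m : RadonMeasure d) :
    ∃ i, MeasurableSet i ∧ m.variation.real univ = m i - m iᶜ := by
  obtain ⟨i, hi, hp, hn, h₁, h₂⟩ := m.toJordanDecomposition_spec
  refine ⟨i, hi, ?_⟩
  rw [← SignedMeasure.totalVariation_eq_variation, SignedMeasure.totalVariation,
    measureReal_add_apply, h₁, h₂, SignedMeasure.toMeasureOfZeroLE_real_apply _ hp hi .univ,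
    SignedMeasure.toMeasureOfLEZero_real_apply _ hn hi.compl .univ]
  simp [sub_eq_add_neg]

/-- The total-variation norm is the mass of the variation measure. -/
theorem tvNorm_eq_variation (m : RadonMeasure d) : tvNorm m = m.variation.real univ := by
  refine le_antisymm (tvNorm_le_of_forall_le m measureReal_nonneg fun φ =>
    (le_abs_self _).trans (abs_integral_le_variation m φ)) ?_
  refine le_of_forall_pos_le_add fun ε hε => ?_
  obtain ⟨i, hi, hm⟩ := exists_variation_eq_sub m
  -- The sign of m. It attains the variation but is not continuous, so it is approximated in
  -- L¹(|m|).
  set h : EuclideanSpace ℝ (Fin d) → ℝ := fun t => i.indicator 1 t - iᶜ.indicator 1 t with hh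
  have hi₁ : Integrable (i.indicator (1 : EuclideanSpace ℝ (Fin d) → ℝ)) m.variation :=
    (integrable_const (1 : ℝ)).indicator hi
  have hi₂ : Integrable (iᶜ.indicator (1 : EuclideanSpace ℝ (Fin d) → ℝ)) m.variation :=
    (integrable_const (1 : ℝ)).indicator hi.compl
  have hint : Integrable h m.variation := hi₁.sub hi₂
  have hval : ∫ᵛ t, h t ∂<•m = m.variation.real univ := by
    rw [hm, hh, VectorMeasure.integral_fun_sub hi₁ hi₂]
    have e (s : Set (EuclideanSpace ℝ (Fin d))) (hs : MeasurableSet s) :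
        ∫ᵛ t, s.indicator 1 t ∂<•m = m s := by
      have := VectorMeasure.integral_indicator_const (μ := m)
        (B := (ContinuousLinearMap.lsmul ℝ ℝ (E := ℝ)).flip) (1 : ℝ) hs
      simpa [Pi.one_def] using this
    rw [e i hi, e _ hi.compl]
  obtain ⟨g, hgs, hg, hgc, hgi⟩ := hint.exists_hasCompactSupport_integral_sub_le hε
  -- Clipping to [-1, 1] makes the approximant admissible and, as h = ±1, brings it no farther from
  -- h.
  have hclip : Continuous fun t => max (-1) (min 1 (g t)) := by fun_prop
  have hclips : HasCompactSupport fun t => max (-1) (min 1 (g t)) := by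
    refine hgs.comp_left (g := fun r : ℝ => max (-1) (min 1 r)) ?_
    norm_num
  let φ : C₀(EuclideanSpace ℝ (Fin d), ℝ) :=
    ⟨⟨fun t => max (-1) (min 1 (g t)), hclip⟩, hclips.is_zero_at_infty⟩
  have hφ (t) : φ t = max (-1) (min 1 (g t)) := rfl
  have hφn : ‖φ‖ ≤ 1 := by
    rw [← ZeroAtInftyContinuousMap.norm_toBCF_eq_norm]
    refine (BoundedContinuousFunction.norm_le zero_le_one).2 fun t => ?_
    change |φ t| ≤ 1
    rw [hφ, abs_le]
    exact ⟨le_max_left _ _, max_le (by norm_num) (min_le_left _ _)⟩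
  have hb : ∀ t, h t = 1 ∨ h t = -1 := fun t => by
    by_cases ht : t ∈ i <;> simp [hh, ht]
  have hd : m.variation.real univ - ∫ᵛ t, φ t ∂<•m ≤ ε := by
    rw [← hval, ← VectorMeasure.integral_fun_sub hint (integrable_zeroAtInfty φ _)]
    refine (le_abs_self _).trans ((abs_integral_le m _).trans (le_trans ?_ hg))
    refine integral_mono_of_nonneg (Eventually.of_forall fun _ => abs_nonneg _) ?_
      (Eventually.of_forall fun t => ?_)
    · exact (hint.sub hgi).norm
    · simp only [hφ, Real.norm_eq_abs]
      rcases hb t with h1 | h1 <;> rw [h1] <;> grind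
  have hle := integral_le_tvNorm_mul_norm m φ
  have h0 : tvNorm m * ‖φ‖ ≤ tvNorm m := mul_le_of_le_one_right (tvNorm_nonneg m) hφn
  linarith

lemma tvNorm_add_le (m n : RadonMeasure d) : tvNorm (m + n) ≤ tvNorm m + tvNorm n := by
  simp only [tvNorm_eq_variation]
  rw [← measureReal_add_apply]
  exact ENNReal.toReal_mono (measure_ne_top _ _) (VectorMeasure.variation_add_le univ)

lemma tvNorm_smul (c : ℝ) (m : RadonMeasure d) : tvNorm (c • m) = |c| * tvNorm m := by
  simp only [tvNorm_eq_variation, VectorMeasure.variation_smul]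
  simp [measureReal_def]

lemma tvNorm_zero : tvNorm (0 : RadonMeasure d) = 0 := by
  simp [tvNorm_eq_variation]

lemma tvNorm_sum_le {ι : Type*} (s : Finset ι) (m : ι → RadonMeasure d) :
    tvNorm (∑ i ∈ s, m i) ≤ ∑ i ∈ s, tvNorm (m i) :=
  Finset.le_sum_of_subadditive _ tvNorm_zero.le tvNorm_add_le s m

lemma tvNorm_restrict (m : RadonMeasure d) {A : Set (EuclideanSpace ℝ (Fin d))}
    (hA : MeasurableSet A) : tvNorm (m.restrict A) = m.variation.real A := by
  rw [tvNorm_eq_variation, VectorMeasure.variation_restrict hA]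
  simp [measureReal_def]

lemma integral_add_measure (m n : RadonMeasure d) (φ : C₀(EuclideanSpace ℝ (Fin d), ℝ)) :
    ∫ᵛ t, φ t ∂<•(m + n) = ∫ᵛ t, φ t ∂<•m + ∫ᵛ t, φ t ∂<•n :=
  VectorMeasure.integral_add_vectorMeasure (integrable_zeroAtInfty φ _)
    (integrable_zeroAtInfty φ _)

lemma integral_smul_measure (c : ℝ) (m : RadonMeasure d) (φ : C₀(EuclideanSpace ℝ (Fin d), ℝ)) :
    ∫ᵛ t, φ t ∂<•(c • m) = c * ∫ᵛ t, φ t ∂<•m :=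
  VectorMeasure.integral_smul_vectorMeasure _ c

lemma integral_sub_toSignedMeasure (μ ν : Measure (EuclideanSpace ℝ (Fin d))) [IsFiniteMeasure μ]
    [IsFiniteMeasure ν] (φ : C₀(EuclideanSpace ℝ (Fin d), ℝ)) :
    ∫ᵛ t, φ t ∂<•(μ.toSignedMeasure - ν.toSignedMeasure) = ∫ t, φ t ∂μ - ∫ t, φ t ∂ν := by
  rw [VectorMeasure.integral_sub_vectorMeasure (integrable_zeroAtInfty φ _)
    (integrable_zeroAtInfty φ _), VectorMeasure.integral_toSignedMeasure,
    VectorMeasure.integral_toSignedMeasure]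

end TotalVariation

/-! ### Weak* compactness of balls -/

section Compactness

open scoped CompactlySupported

variable {d : ℕ}

/-- A compactly supported continuous function, as a function vanishing at infinity. -/
def toZeroAtInfty (f : C_c(EuclideanSpace ℝ (Fin d), ℝ)) : C₀(EuclideanSpace ℝ (Fin d), ℝ) :=
  ⟨f.toContinuousMap, f.hasCompactSupport.is_zero_at_infty⟩

lemma norm_zeroAtInfty_le {φ : C₀(EuclideanSpace ℝ (Fin d), ℝ)} {C : ℝ} (hC : 0 ≤ C)
    (h : ∀ t, |φ t| ≤ C) : ‖φ‖ ≤ C := by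
  rw [← ZeroAtInftyContinuousMap.norm_toBCF_eq_norm]
  exact (BoundedContinuousFunction.norm_le hC).2 h

/-- Compactly supported functions are dense in `C₀`. -/
lemma exists_norm_sub_toZeroAtInfty_le (φ : C₀(EuclideanSpace ℝ (Fin d), ℝ)) {ε : ℝ}
    (hε : 0 < ε) : ∃ f : C_c(EuclideanSpace ℝ (Fin d), ℝ), ‖φ - toZeroAtInfty f‖ ≤ ε := by
  -- Soft thresholding: the difference vanishes where |φ| ≤ ε, hence off a compact set.
  have hcont : Continuous fun t => φ t - max (-ε) (min ε (φ t)) := by fun_prop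
  have hsupp : HasCompactSupport fun t => φ t - max (-ε) (min ε (φ t)) := by
    have h := (ZeroAtInftyContinuousMap.zero_at_infty' φ).eventually
      (Metric.closedBall_mem_nhds (0 : ℝ) hε)
    rw [Filter.Eventually, Filter.mem_cocompact] at h
    obtain ⟨K, hK, hKs⟩ := h
    refine HasCompactSupport.intro hK fun t ht => ?_
    have h1 : |φ t| ≤ ε := by simpa using hKs ht
    rw [abs_le] at h1
    rw [min_eq_right h1.2, max_eq_right h1.1, sub_self]
  refine ⟨⟨⟨_, hcont⟩, hsupp⟩, norm_zeroAtInfty_le hε.le fun t => ?_⟩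
  change |φ t - (φ t - max (-ε) (min ε (φ t)))| ≤ ε
  rw [sub_sub_cancel, abs_le]
  exact ⟨le_max_left _ _, max_le (by linarith) (min_le_left _ _)⟩

/-- Positive functionals on `C₀` are integrals against finite measures. -/
theorem exists_measure_of_positive (Λ : StrongDual ℝ C₀(EuclideanSpace ℝ (Fin d), ℝ))
    (hΛ : ∀ φ : C₀(EuclideanSpace ℝ (Fin d), ℝ), (∀ t, 0 ≤ φ t) → 0 ≤ Λ φ) :
    ∃ μ : Measure (EuclideanSpace ℝ (Fin d)), IsFiniteMeasure μ ∧ ∀ φ, ∫ t, φ t ∂μ = Λ φ := by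
  let T : C_c(EuclideanSpace ℝ (Fin d), ℝ) →ₗ[ℝ] ℝ :=
    { toFun := fun f => Λ (toZeroAtInfty f)
      map_add' := fun f g => by rw [← map_add]; rfl
      map_smul' := fun c f => by rw [RingHom.id_apply, ← map_smul]; rfl }
  let P : C_c(EuclideanSpace ℝ (Fin d), ℝ) →ₚ[ℝ] ℝ :=
    PositiveLinearMap.mk₀ T fun f hf => hΛ _ fun t => hf t
  have hP (f) : P f = Λ (toZeroAtInfty f) := rfl
  -- By inner regularity it suffices to bound compact sets; a cutoff of norm at most 1 equal to 1 on
  -- K gives the bound ‖Λ‖.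
  have hfin : IsFiniteMeasure (RealRMK.rieszMeasure P) := by
    refine ⟨lt_of_le_of_lt ?_ (ENNReal.ofReal_lt_top (r := ‖Λ‖))⟩
    rw [isOpen_univ.measure_eq_iSup_isCompact]
    refine iSup₂_le fun K _ => iSup_le fun hK => ?_
    obtain ⟨f, hf1, -, hfs, hf01⟩ :=
      exists_continuous_one_zero_of_isCompact hK isClosed_empty (disjoint_empty K)
    refine (RealRMK.rieszMeasure_le_of_eq_one P (f := ⟨f, hfs⟩) (fun t => (hf01 t).1) hK
      fun t ht => hf1 ht).trans (ENNReal.ofReal_le_ofReal ?_)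
    rw [hP]
    refine (le_abs_self _).trans ((Λ.le_opNorm _).trans (mul_le_of_le_one_right (norm_nonneg _) ?_))
    refine norm_zeroAtInfty_le zero_le_one fun t => ?_
    change |f t| ≤ 1
    rw [abs_of_nonneg (hf01 t).1]
    exact (hf01 t).2
  refine ⟨RealRMK.rieszMeasure P, hfin, fun φ => ?_⟩
  set M := (RealRMK.rieszMeasure P).real univ
  refine eq_of_abs_sub_le_all fun ε hε => ?_
  have hM : 0 < M + ‖Λ‖ + 1 := by positivity
  obtain ⟨f, hf⟩ := exists_norm_sub_toZeroAtInfty_le φ (div_pos hε hM)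
  have h1 : ∫ t, toZeroAtInfty f t ∂(RealRMK.rieszMeasure P) = Λ (toZeroAtInfty f) := by
    rw [← hP, ← RealRMK.integral_rieszMeasure P f]
    rfl
  have h2 : |∫ t, φ t ∂(RealRMK.rieszMeasure P) -
      ∫ t, toZeroAtInfty f t ∂(RealRMK.rieszMeasure P)| ≤ ‖φ - toZeroAtInfty f‖ * M := by
    rw [← integral_sub (integrable_zeroAtInfty _ _) (integrable_zeroAtInfty _ _)]
    exact norm_integral_le_of_norm_le_const (Eventually.of_forall fun t =>
      (φ - toZeroAtInfty f).toBCF.norm_coe_le_norm t)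
  have h3 : |Λ φ - Λ (toZeroAtInfty f)| ≤ ‖Λ‖ * ‖φ - toZeroAtInfty f‖ := by
    rw [← map_sub]
    exact Λ.le_opNorm _
  rw [h1] at h2
  have h4 : ‖φ - toZeroAtInfty f‖ * (M + ‖Λ‖ + 1) ≤ ε := (le_div_iff₀ hM).1 hf
  have h5 := norm_nonneg (φ - toZeroAtInfty f)
  have h6 := abs_sub_le (∫ t, φ t ∂(RealRMK.rieszMeasure P)) (Λ (toZeroAtInfty f)) (Λ φ)
  rw [abs_sub_comm (Λ (toZeroAtInfty f))] at h6
  nlinarith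

/-- The functional on `C₀` given by integration against a finite measure. -/
def integralFunctional (μ : Measure (EuclideanSpace ℝ (Fin d))) [IsFiniteMeasure μ] :
    StrongDual ℝ C₀(EuclideanSpace ℝ (Fin d), ℝ) :=
  LinearMap.mkContinuous
    { toFun := fun φ => ∫ t, φ t ∂μ
      map_add' := fun φ ψ => integral_add (integrable_zeroAtInfty φ μ) (integrable_zeroAtInfty ψ μ)
      map_smul' := fun c φ => integral_const_mul c _ }
    (μ.real univ) fun φ => by
      rw [mul_comm]
      exact norm_integral_le_of_norm_le_const (Eventually.of_forall fun t =>
        φ.toBCF.norm_coe_le_norm t)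

lemma norm_integralFunctional_le (μ : Measure (EuclideanSpace ℝ (Fin d))) [IsFiniteMeasure μ] :
    ‖integralFunctional μ‖ ≤ μ.real univ :=
  LinearMap.mkContinuous_norm_le _ measureReal_nonneg _

lemma toWeakDual_mem_preimage_closedBall {E : Type*} [NormedAddCommGroup E] [NormedSpace ℝ E]
    {Λ : StrongDual ℝ E} {C : ℝ} (h : ‖Λ‖ ≤ C) :
    StrongDual.toWeakDual Λ ∈ WeakDual.toStrongDual ⁻¹' Metric.closedBall (0 : StrongDual ℝ E) C :=
  mem_closedBall_zero_iff.2 h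

/-- Balls of the total-variation norm are compact for the topology of pointwise convergence on
`C₀`. -/
theorem isCompact_image_tvNorm_le (C : ℝ) :
    IsCompact ((fun (m : RadonMeasure d) (φ : C₀(EuclideanSpace ℝ (Fin d), ℝ)) =>
      ∫ᵛ t, φ t ∂<•m) '' {m | tvNorm m ≤ C}) := by
  let E := C₀(EuclideanSpace ℝ (Fin d), ℝ)
  -- Positivity is a closed condition, so Riesz–Markov is only needed for positive functionals;
  -- signed ones are differences of two of these.
  let B : Set (WeakDual ℝ E) := WeakDual.toStrongDual ⁻¹' Metric.closedBall 0 C ∩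
    {Λ | ∀ φ : E, (∀ t, 0 ≤ φ t) → 0 ≤ Λ φ}
  have hB : IsCompact B := by
    refine (WeakDual.isCompact_closedBall 0 C).inter_right ?_
    simp only [ofPred_forall]
    exact isClosed_iInter fun φ => isClosed_iInter fun _ =>
      isClosed_le continuous_const (WeakDual.eval_continuous φ)
  have hD : IsCompact ((fun (p : WeakDual ℝ E × WeakDual ℝ E) (φ : E) => p.1 φ - p.2 φ) ''
      (B ×ˢ B)) := by
    refine (hB.prod hB).image (continuous_pi fun φ => ?_)
    exact ((WeakDual.eval_continuous φ).comp continuous_fst).sub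
      ((WeakDual.eval_continuous φ).comp continuous_snd)
  -- Differences of elements of B may have norm up to 2C; this closed condition restores the bound
  -- C.
  have hcl : IsClosed {F : E → ℝ | ∀ φ, F φ ≤ C * ‖φ‖} := by
    simp only [ofPred_forall]
    exact isClosed_iInter fun φ => isClosed_le (continuous_apply φ) continuous_const
  convert hD.inter_right hcl using 1
  ext F
  constructor
  · rintro ⟨m, hm, rfl⟩
    have hm' : tvNorm m ≤ C := hm
    refine ⟨?_, fun φ => (integral_le_tvNorm_mul_norm m φ).trans (by gcongr)⟩
    have hsum : m.toJordanDecomposition.posPart.real univ +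
        m.toJordanDecomposition.negPart.real univ = tvNorm m := by
      rw [tvNorm_eq_variation, ← SignedMeasure.totalVariation_eq_variation,
        SignedMeasure.totalVariation, measureReal_add_apply]
    have h1 := measureReal_nonneg (μ := m.toJordanDecomposition.posPart) (s := univ)
    have h2 := measureReal_nonneg (μ := m.toJordanDecomposition.negPart) (s := univ)
    have hmem (μ : Measure (EuclideanSpace ℝ (Fin d))) [IsFiniteMeasure μ] (hμ : μ.real univ ≤ C) :
        StrongDual.toWeakDual (integralFunctional μ) ∈ B := by
      refine ⟨?_, fun φ hφ => integral_nonneg hφ⟩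
      exact toWeakDual_mem_preimage_closedBall ((norm_integralFunctional_le μ).trans hμ)
    refine ⟨(StrongDual.toWeakDual (integralFunctional m.toJordanDecomposition.posPart),
      StrongDual.toWeakDual (integralFunctional m.toJordanDecomposition.negPart)),
      ⟨hmem _ (by linarith), hmem _ (by linarith)⟩, ?_⟩
    funext φ
    conv_rhs => rw [← m.toSignedMeasure_toJordanDecomposition]
    exact (integral_sub_toSignedMeasure _ _ φ).symm
  · rintro ⟨⟨⟨Λ₁, Λ₂⟩, ⟨⟨h1, h1'⟩, -, h2'⟩, rfl⟩, hF⟩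
    have hC : 0 ≤ C := dist_nonneg.trans h1
    obtain ⟨μ, _, hμ⟩ := exists_measure_of_positive (WeakDual.toStrongDual Λ₁) h1'
    obtain ⟨ν, _, hν⟩ := exists_measure_of_positive (WeakDual.toStrongDual Λ₂) h2'
    have he (φ : E) : ∫ᵛ t, φ t ∂<•(μ.toSignedMeasure - ν.toSignedMeasure) = Λ₁ φ - Λ₂ φ := by
      rw [integral_sub_toSignedMeasure, hμ, hν]
      rfl
    refine ⟨μ.toSignedMeasure - ν.toSignedMeasure,
      tvNorm_le_of_forall_le _ hC fun φ => ?_, funext he⟩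
    rw [he]
    exact hF φ

/-- Balls of a Hilbert space are weakly compact. -/
theorem isCompact_image_closedBall {H : Type} [NormedAddCommGroup H] [InnerProductSpace ℝ H]
    [CompleteSpace H] (R : ℝ) :
    IsCompact ((fun (f h : H) => ⟪h, f⟫_ℝ) '' Metric.closedBall 0 R) := by
  -- Banach–Alaoglu in the dual, carried back to H by the Riesz isometry.
  have h := (WeakDual.isCompact_closedBall (0 : StrongDual ℝ H) R).image
    (f := fun (Λ : WeakDual ℝ H) (g : H) => Λ g) (continuous_pi fun φ => WeakDual.eval_continuous φ)
  convert h using 1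
  ext F
  constructor
  · rintro ⟨f, hf, rfl⟩
    refine ⟨StrongDual.toWeakDual (InnerProductSpace.toDual ℝ H f), by simpa using hf, ?_⟩
    funext g
    exact (InnerProductSpace.toDual_apply_apply).trans (real_inner_comm _ _)
  · rintro ⟨Λ, hΛ, rfl⟩
    refine ⟨(InnerProductSpace.toDual ℝ H).symm (WeakDual.toStrongDual Λ), by simpa using hΛ, ?_⟩
    funext g
    exact (real_inner_comm _ _).trans InnerProductSpace.toDual_symm_apply

/-- Products of balls are weak* compact. -/
theorem isWeakStarCompact_ball_prod {H : Type} [NormedAddCommGroup H] [InnerProductSpace ℝ H]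
    [CompleteSpace H] (C R : ℝ) :
    IsWeakStarCompact ({m : RadonMeasure d | tvNorm m ≤ C} ×ˢ Metric.closedBall (0 : H) R) := by
  unfold IsWeakStarCompact
  let := weakStarTopology d H
  rw [(Topology.IsInducing.induced _).isCompact_iff]
  convert (isCompact_image_tvNorm_le (d := d) C).prod (isCompact_image_closedBall (H := H) R) using 1
  exact (prod_image_image_eq (m₁ := fun (m : RadonMeasure d)
    (φ : C₀(EuclideanSpace ℝ (Fin d), ℝ)) => ∫ᵛ t, φ t ∂<•m)
    (m₂ := fun (f h : H) => ⟪h, f⟫_ℝ)).symm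

end Compactness

/-! ### Semicontinuity, existence, convexity and uniqueness of the measurements -/

section Objective

variable {d L : ℕ}

/-- The translated and reflected Gaussian as an element of `C₀`. -/
def gaussianShift {σ : ℝ} (hσ : 0 < σ) (u : EuclideanSpace ℝ (Fin d)) :
    C₀(EuclideanSpace ℝ (Fin d), ℝ) where
  toFun t := gaussianDensity d σ (u - t)
  continuous_toFun := (continuous_gaussianDensity d σ).comp (continuous_const.sub continuous_id)
  zero_at_infty' := by
    have h1 : Tendsto (fun t : EuclideanSpace ℝ (Fin d) => ‖u - t‖) (cocompact _) atTop :=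
      (tendsto_norm_cocompact_atTop (E := EuclideanSpace ℝ (Fin d))).comp
        (Homeomorph.subLeft u).isClosedEmbedding.tendsto_cocompact
    have h2 : Tendsto (fun r : ℝ => Real.exp (-r ^ 2 / (2 * σ ^ 2))) atTop (𝓝 0) := by
      refine Real.tendsto_exp_atBot.comp ?_
      have h3 : Tendsto (fun r : ℝ => r ^ 2 / (2 * σ ^ 2)) atTop atTop :=
        (tendsto_pow_atTop two_ne_zero).atTop_div_const (by positivity)
      simpa only [neg_div, Function.comp_def] using tendsto_neg_atTop_atBot.comp h3
    simpa [gaussianDensity] using (h2.comp h1).const_mul (1 / (Real.sqrt (2 * Real.pi * σ ^ 2)) ^ d)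

lemma measB_apply {σ : ℝ} (hσ : 0 < σ) (x : Fin L → EuclideanSpace ℝ (Fin d))
    (m : RadonMeasure d) (l : Fin L) :
    measB σ x m l = ∫ᵛ t, gaussianShift hσ (x l) t ∂<•m := rfl

lemma measB_add {σ : ℝ} (hσ : 0 < σ) (x : Fin L → EuclideanSpace ℝ (Fin d))
    (m n : RadonMeasure d) : measB σ x (m + n) = measB σ x m + measB σ x n := by
  ext l
  simp only [measB_apply hσ, PiLp.add_apply, integral_add_measure]

lemma measB_smul {σ : ℝ} (hσ : 0 < σ) (x : Fin L → EuclideanSpace ℝ (Fin d))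
    (c : ℝ) (m : RadonMeasure d) : measB σ x (c • m) = c • measB σ x m := by
  ext l
  simp only [measB_apply hσ, PiLp.smul_apply, integral_smul_measure, smul_eq_mul]

/-- `Φ_B` as a linear map. -/
def measBLin {σ : ℝ} (hσ : 0 < σ) (x : Fin L → EuclideanSpace ℝ (Fin d)) :
    RadonMeasure d →ₗ[ℝ] EuclideanSpace ℝ (Fin L) where
  toFun := measB σ x
  map_add' := measB_add hσ x
  map_smul' := measB_smul hσ x

lemma measH_apply (σ₀ σ : ℝ) (x : Fin L → EuclideanSpace ℝ (Fin d)) (f : GaussianRKHS d σ₀)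
    (l : Fin L) : measH σ₀ σ x f l = ⟪representer σ₀ σ x l, f⟫_ℝ :=
  (InnerProductSpace.toDual_symm_apply (y := convEval d σ₀ σ (x l))).symm

section Semicontinuity

variable {H : Type} [NormedAddCommGroup H] [InnerProductSpace ℝ H]

lemma continuous_weakStarEmbedding :
    @Continuous _ _ (weakStarTopology d H) _ fun p : RadonMeasure d × H =>
      ((fun φ : C₀(EuclideanSpace ℝ (Fin d), ℝ) => ∫ᵛ t, φ t ∂<•p.1), (fun h : H => ⟪h, p.2⟫_ℝ)) :=
  continuous_induced_dom

lemma continuous_integral_fst (φ : C₀(EuclideanSpace ℝ (Fin d), ℝ)) :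
    @Continuous _ _ (weakStarTopology d H) _ fun p : RadonMeasure d × H => ∫ᵛ t, φ t ∂<•p.1 :=
  let := weakStarTopology d H
  (continuous_apply (A := fun _ => ℝ) φ).comp (continuous_fst.comp (continuous_weakStarEmbedding (H := H)))

lemma continuous_inner_snd (h : H) :
    @Continuous _ _ (weakStarTopology d H) _ fun p : RadonMeasure d × H => ⟪h, p.2⟫_ℝ :=
  let := weakStarTopology d H
  (continuous_apply (A := fun _ => ℝ) h).comp (continuous_snd.comp (continuous_weakStarEmbedding (H := H)))

/-- A supremum of weak* continuous functionals: a test function violating the bound c at p still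
does so nearby. -/
lemma lowerSemicontinuous_tvNorm :
    @LowerSemicontinuous _ _ (weakStarTopology d H) _
      fun p : RadonMeasure d × H => tvNorm p.1 := by
  let := weakStarTopology d H
  intro p c hc
  rcases lt_or_ge c 0 with h0 | h0
  · exact Eventually.of_forall fun q => h0.trans_le (tvNorm_nonneg q.1)
  have : ∃ φ : C₀(EuclideanSpace ℝ (Fin d), ℝ), ¬ ∫ᵛ t, φ t ∂<•p.1 ≤ c * ‖φ‖ := by
    by_contra! h
    exact (tvNorm_le_of_forall_le _ h0 h).not_gt hc
  obtain ⟨φ, hφ⟩ := this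
  filter_upwards [(continuous_integral_fst φ).tendsto p |>.eventually
    (lt_mem_nhds (not_le.1 hφ))] with q hq
  exact lt_of_mul_lt_mul_right (hq.trans_le (integral_le_tvNorm_mul_norm q.1 φ)) (norm_nonneg φ)

/-- The weakly continuous affine function 2⟪p, q⟫ - ‖p‖² of q minorizes ‖q‖², with equality at q =
p. -/
lemma lowerSemicontinuous_norm_sq :
    @LowerSemicontinuous _ _ (weakStarTopology d H) _
      fun p : RadonMeasure d × H => ‖p.2‖ ^ 2 := by
  let := weakStarTopology d H
  intro p c hc
  have hcont : Continuous fun q : RadonMeasure d × H => 2 * ⟪p.2, q.2⟫_ℝ - ‖p.2‖ ^ 2 :=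
    ((continuous_inner_snd p.2).const_mul 2).sub continuous_const
  have h0 : c < 2 * ⟪p.2, p.2⟫_ℝ - ‖p.2‖ ^ 2 := by
    rw [real_inner_self_eq_norm_sq]
    linarith
  filter_upwards [hcont.tendsto p |>.eventually (lt_mem_nhds h0)] with q hq
  have h1 := sq_nonneg ‖p.2 - q.2‖
  rw [@norm_sub_sq_real] at h1
  linarith

end Semicontinuity

variable {σ₀ σ lam₁ lam₂ : ℝ} (x : Fin L → EuclideanSpace ℝ (Fin d))
  (y : EuclideanSpace ℝ (Fin L))

lemma lowerSemicontinuous_objective (hσ : 0 < σ) (hlam₁ : 0 < lam₁) (hlam₂ : 0 < lam₂) :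
    @LowerSemicontinuous _ _ (weakStarTopology d (GaussianRKHS d σ₀)) _
      (objective σ₀ σ x lam₁ lam₂ y) := by
  let := weakStarTopology d (GaussianRKHS d σ₀)
  have hcont : Continuous fun s : RadonMeasure d × GaussianRKHS d σ₀ =>
      1 / 2 * ‖y - (measB σ x s.1 + measH σ₀ σ x s.2)‖ ^ 2 := by
    have hc : Continuous fun s : RadonMeasure d × GaussianRKHS d σ₀ =>
        (WithLp.toLp 2 fun l => ∫ᵛ t, gaussianShift hσ (x l) t ∂<•s.1 +
          ⟪representer σ₀ σ x l, s.2⟫_ℝ : EuclideanSpace ℝ (Fin L)) :=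
      (PiLp.continuous_toLp 2 _).comp (continuous_pi fun l =>
        (continuous_integral_fst _).add (continuous_inner_snd _))
    have this : Continuous fun s : RadonMeasure d × GaussianRKHS d σ₀ =>
        measB σ x s.1 + measH σ₀ σ x s.2 := by
      refine hc.congr fun s => ?_
      ext l
      rw [PiLp.add_apply, measB_apply hσ, measH_apply]
    exact ((continuous_const.sub this).norm.pow 2).const_mul _
  refine (hcont.lowerSemicontinuous.add ?_).add ?_
  · exact (continuous_const_mul lam₁).comp_lowerSemicontinuous lowerSemicontinuous_tvNorm
      (monotone_mul_left_of_nonneg hlam₁.le)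
  · exact (continuous_const_mul (lam₂ / 2)).comp_lowerSemicontinuous lowerSemicontinuous_norm_sq
      (monotone_mul_left_of_nonneg (by positivity))

/-- Coercivity: all three terms are nonnegative, so each penalty alone is at most c. -/
lemma mem_ball_of_objective_le (hlam₁ : 0 < lam₁) (hlam₂ : 0 < lam₂) {c : ℝ}
    {s : RadonMeasure d × GaussianRKHS d σ₀} (hs : objective σ₀ σ x lam₁ lam₂ y s ≤ c) :
    s ∈ {m : RadonMeasure d | tvNorm m ≤ c / lam₁} ×ˢ
      Metric.closedBall (0 : GaussianRKHS d σ₀) (√(2 * c / lam₂)) := by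
  unfold objective at hs
  have h1 := sq_nonneg ‖y - (measB σ x s.1 + measH σ₀ σ x s.2)‖
  have h2 : 0 ≤ lam₁ * tvNorm s.1 := mul_nonneg hlam₁.le (tvNorm_nonneg _)
  have h3 : 0 ≤ lam₂ / 2 * ‖s.2‖ ^ 2 := by positivity
  refine ⟨?_, mem_closedBall_zero_iff.2 (Real.le_sqrt_of_sq_le ?_)⟩
  · change tvNorm s.1 ≤ c / lam₁
    rw [le_div_iff₀ hlam₁]
    linarith
  · rw [le_div_iff₀ hlam₂]
    linarith

theorem nonempty_solutionSet (hσ : 0 < σ) (hlam₁ : 0 < lam₁) (hlam₂ : 0 < lam₂) :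
    (solutionSet σ₀ σ x lam₁ lam₂ y).Nonempty := by
  let := weakStarTopology d (GaussianRKHS d σ₀)
  -- The radii are those for c equal to the objective at 0; anything outside this product does worse
  -- than 0.
  obtain ⟨s, -, hs⟩ := LowerSemicontinuousOn.exists_isMinOn
    ⟨0, mem_ball_of_objective_le (σ₀ := σ₀) (σ := σ) x y hlam₁ hlam₂ le_rfl⟩
    (isWeakStarCompact_ball_prod (d := d) (H := GaussianRKHS d σ₀) _ _)
    ((lowerSemicontinuous_objective (σ₀ := σ₀) x y hσ hlam₁ hlam₂).lowerSemicontinuousOn _)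
  refine ⟨s, fun t => ?_⟩
  rcases le_total (objective σ₀ σ x lam₁ lam₂ y t) (objective σ₀ σ x lam₁ lam₂ y 0) with h | h
  · exact hs (mem_ball_of_objective_le x y hlam₁ hlam₂ h)
  · exact (hs (mem_ball_of_objective_le x y hlam₁ hlam₂ le_rfl)).trans h

theorem isWeakStarCompact_solutionSet (hσ : 0 < σ) (hlam₁ : 0 < lam₁) (hlam₂ : 0 < lam₂) :
    IsWeakStarCompact (solutionSet σ₀ σ x lam₁ lam₂ y) := by
  unfold IsWeakStarCompact
  let := weakStarTopology d (GaussianRKHS d σ₀)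
  obtain ⟨s, hs⟩ := nonempty_solutionSet (σ₀ := σ₀) x y hσ hlam₁ hlam₂
  have he : solutionSet σ₀ σ x lam₁ lam₂ y =
      objective σ₀ σ x lam₁ lam₂ y ⁻¹' Iic (objective σ₀ σ x lam₁ lam₂ y s) :=
    ext fun t => ⟨fun ht => ht s, fun ht u => le_trans ht (hs u)⟩
  have hcl : IsClosed (solutionSet σ₀ σ x lam₁ lam₂ y) := by
    rw [he]
    exact (lowerSemicontinuous_objective x y hσ hlam₁ hlam₂).isClosed_preimage _
  exact IsCompact.of_isClosed_subset (isWeakStarCompact_ball_prod (d := d) _ _) hcl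
    fun t ht => mem_ball_of_objective_le x y hlam₁ hlam₂ (ht s)

lemma norm_sq_convexCombination {E : Type*} [NormedAddCommGroup E] [InnerProductSpace ℝ E]
    (u v : E) {a b : ℝ} (hab : a + b = 1) :
    ‖a • u + b • v‖ ^ 2 = a * ‖u‖ ^ 2 + b * ‖v‖ ^ 2 - a * b * ‖u - v‖ ^ 2 := by
  obtain rfl : b = 1 - a := by linarith
  rw [@norm_add_sq_real, @norm_sub_sq_real, norm_smul, norm_smul, mul_pow, mul_pow,
    Real.norm_eq_abs, Real.norm_eq_abs, sq_abs, sq_abs, real_inner_smul_left,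
    real_inner_smul_right]
  ring

/-- Strong convexity of the objective in the measurements and in the smooth component. -/
lemma objective_convexCombination_le (hσ : 0 < σ) (hlam₁ : 0 < lam₁)
    (s t : RadonMeasure d × GaussianRKHS d σ₀) {a b : ℝ} (ha : 0 ≤ a) (hb : 0 ≤ b)
    (hab : a + b = 1) :
    objective σ₀ σ x lam₁ lam₂ y (a • s + b • t) ≤
      a * objective σ₀ σ x lam₁ lam₂ y s + b * objective σ₀ σ x lam₁ lam₂ y t -
      a * b * (1 / 2 * ‖(measB σ x s.1 + measH σ₀ σ x s.2) -
        (measB σ x t.1 + measH σ₀ σ x t.2)‖ ^ 2 + lam₂ / 2 * ‖s.2 - t.2‖ ^ 2) := by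
  have h1 : tvNorm (a • s.1 + b • t.1) ≤ a * tvNorm s.1 + b * tvNorm t.1 := by
    refine (tvNorm_add_le _ _).trans_eq ?_
    rw [tvNorm_smul, tvNorm_smul, abs_of_nonneg ha, abs_of_nonneg hb]
  have h2 : y - (measB σ x (a • s + b • t).1 + measH σ₀ σ x (a • s + b • t).2) =
      a • (y - (measB σ x s.1 + measH σ₀ σ x s.2)) +
      b • (y - (measB σ x t.1 + measH σ₀ σ x t.2)) := by
    simp only [Prod.fst_add, Prod.snd_add, Prod.smul_fst, Prod.smul_snd, measB_add hσ,
      measB_smul hσ, map_add, map_smul]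
    obtain rfl : b = 1 - a := by linarith
    module
  unfold objective
  rw [h2, norm_sq_convexCombination _ _ hab, sub_sub_sub_cancel_left, norm_sub_rev (measB σ x t.1 + _)]
  simp only [Prod.fst_add, Prod.snd_add, Prod.smul_fst, Prod.smul_snd]
  rw [norm_sq_convexCombination s.2 t.2 hab]
  have h3 := mul_le_mul_of_nonneg_left h1 hlam₁.le
  linarith

theorem convex_solutionSet (hσ : 0 < σ) (hlam₁ : 0 < lam₁) (hlam₂ : 0 < lam₂) :
    Convex ℝ (solutionSet σ₀ σ x lam₁ lam₂ y) := by
  intro s hs t ht a b ha hb hab u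
  refine (objective_convexCombination_le x y hσ hlam₁ s t ha hb hab).trans ?_
  have h1 := mul_le_mul_of_nonneg_left (hs u) ha
  have h2 := mul_le_mul_of_nonneg_left (ht u) hb
  have h3 : 0 ≤ a * b * (1 / 2 * ‖(measB σ x s.1 + measH σ₀ σ x s.2) -
        (measB σ x t.1 + measH σ₀ σ x t.2)‖ ^ 2 + lam₂ / 2 * ‖s.2 - t.2‖ ^ 2) := by positivity
  have h4 : a * objective σ₀ σ x lam₁ lam₂ y u + b * objective σ₀ σ x lam₁ lam₂ y u =
      objective σ₀ σ x lam₁ lam₂ y u := by rw [← add_mul, hab, one_mul]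
  linarith

/-- All minimizers produce the same measurements of the sparse component. -/
theorem measB_eq_of_mem_solutionSet (hσ : 0 < σ) (hlam₁ : 0 < lam₁) (hlam₂ : 0 < lam₂)
    {s t : RadonMeasure d × GaussianRKHS d σ₀} (hs : s ∈ solutionSet σ₀ σ x lam₁ lam₂ y)
    (ht : t ∈ solutionSet σ₀ σ x lam₁ lam₂ y) : measB σ x s.1 = measB σ x t.1 := by
  -- The midpoint cannot beat the minimum, so the strong convexity gain must vanish.
  have h := (hs _).trans (objective_convexCombination_le x y hσ hlam₁ (lam₂ := lam₂) s t
    (a := 1 / 2) (b := 1 / 2) (by norm_num) (by norm_num) (by norm_num))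
  have hts := ht s
  set u := (measB σ x s.1 + measH σ₀ σ x s.2) - (measB σ x t.1 + measH σ₀ σ x t.2) with hu
  have h1 : 0 ≤ 1 / 2 * ‖u‖ ^ 2 := by positivity
  have h2 : 0 ≤ lam₂ / 2 * ‖s.2 - t.2‖ ^ 2 := by positivity
  have h3 : ‖u‖ ^ 2 = 0 := by linarith
  have h4 : lam₂ / 2 * ‖s.2 - t.2‖ ^ 2 = 0 := by linarith
  have h5 : s.2 = t.2 := by
    rw [mul_eq_zero_iff_left (by positivity), sq_eq_zero_iff, norm_eq_zero, sub_eq_zero] at h4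
    exact h4
  rw [sq_eq_zero_iff, norm_eq_zero, hu, h5, sub_eq_zero] at h3
  exact add_right_cancel h3

end Objective

/-! ### The smooth component -/

section Smooth

variable {d L : ℕ} {σ₀ σ lam₁ lam₂ : ℝ} (x : Fin L → EuclideanSpace ℝ (Fin d))
  (y : EuclideanSpace ℝ (Fin L))

/-- First-order optimality condition in the smooth component. -/
theorem smul_snd_eq_adjoint_residual (hlam₂ : 0 < lam₂)
    {s : RadonMeasure d × GaussianRKHS d σ₀} (hs : s ∈ solutionSet σ₀ σ x lam₁ lam₂ y) :
    lam₂ • s.2 = (measH σ₀ σ x).adjoint (y - (measB σ x s.1 + measH σ₀ σ x s.2)) := by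
  set r := y - (measB σ x s.1 + measH σ₀ σ x s.2) with hr
  set h := lam₂ • s.2 - (measH σ₀ σ x).adjoint r with hh
  have hin : ‖h‖ ^ 2 = lam₂ * ⟪s.2, h⟫_ℝ - ⟪r, measH σ₀ σ x h⟫_ℝ := by
    rw [← ContinuousLinearMap.adjoint_inner_left, ← real_inner_smul_left, ← inner_sub_left, ← hh,
      real_inner_self_eq_norm_sq]
  set A := 1 / 2 * ‖measH σ₀ σ x h‖ ^ 2 + lam₂ / 2 * ‖h‖ ^ 2 with hA
  have hA0 : 0 ≤ A := by positivity
  -- Perturbation along h, the gradient in s₂ itself; the right side is the exact change of the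
  -- objective.
  have key (ε : ℝ) : 0 ≤ ε * ‖h‖ ^ 2 + ε ^ 2 * A := by
    have h1 := hs (s.1, s.2 + ε • h)
    unfold objective at h1
    have h2 : y - (measB σ x s.1 + measH σ₀ σ x (s.2 + ε • h)) = r - ε • measH σ₀ σ x h := by
      rw [map_add, map_smul, hr]
      abel
    simp only [h2, ← hr] at h1
    rw [norm_sub_sq_real r, norm_add_sq_real s.2, norm_smul, norm_smul, mul_pow, mul_pow,
      Real.norm_eq_abs, sq_abs, real_inner_smul_right, real_inner_smul_right] at h1
    rw [hin, hA]
    linarith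
  -- A descent step; A + 1 instead of A keeps the denominator nonzero, and the value is still
  -- negative unless h = 0.
  have h3 := key (-‖h‖ ^ 2 / (A + 1))
  have h4 : -‖h‖ ^ 2 / (A + 1) * ‖h‖ ^ 2 + (-‖h‖ ^ 2 / (A + 1)) ^ 2 * A =
      -((‖h‖ ^ 2) ^ 2 / (A + 1) ^ 2) := by
    field_simp
    ring
  rw [h4] at h3
  have h5 : (‖h‖ ^ 2) ^ 2 / (A + 1) ^ 2 = 0 := le_antisymm (by linarith) (by positivity)
  rw [div_eq_zero_iff, or_iff_left (by positivity), sq_eq_zero_iff, sq_eq_zero_iff,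
    norm_eq_zero] at h5
  exact sub_eq_zero.1 h5

/-- The Gram matrix of the representers is the matrix of Φ_H Φ_H*. -/
lemma toEuclideanLin_matM (hlam₂ : 0 < lam₂) (p : EuclideanSpace ℝ (Fin L)) :
    Matrix.toEuclideanLin (matM σ₀ σ x lam₂) p =
      (1 / lam₂) • measH σ₀ σ x ((measH σ₀ σ x).adjoint p) + p := by
  ext k
  have h : measH σ₀ σ x ((measH σ₀ σ x).adjoint p) k =
      ∑ l, ⟪representer σ₀ σ x k, representer σ₀ σ x l⟫_ℝ * p l := by
    rw [measH_apply, ContinuousLinearMap.adjoint_inner_right, PiLp.inner_apply]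
    simp only [measH_apply]
    refine Finset.sum_congr rfl fun l _ => ?_
    rw [real_inner_comm (representer σ₀ σ x k), RCLike.inner_apply, conj_trivial, mul_comm]
  rw [PiLp.add_apply, PiLp.smul_apply, h]
  simp only [matM, Matrix.toLpLin_apply, Matrix.smul_mulVec, Matrix.add_mulVec, Matrix.one_mulVec,
    Pi.smul_apply, Pi.add_apply, smul_eq_mul, Matrix.mulVec, dotProduct, Matrix.of_apply]
  field_simp

/-- Positive definiteness: ⟪p, M p⟫ = ‖Φ_H* p‖² / λ₂ + ‖p‖². Thus the matrix `⁻¹` is a genuine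
inverse. -/
lemma isUnit_det_matM (hlam₂ : 0 < lam₂) : IsUnit (matM σ₀ σ x lam₂).det := by
  rw [← Matrix.isUnit_iff_isUnit_det, ← Matrix.mulVec_injective_iff_isUnit]
  refine (injective_iff_map_eq_zero (matM σ₀ σ x lam₂).mulVecLin).2 fun v hv => ?_
  have h := toEuclideanLin_matM (σ₀ := σ₀) (σ := σ) x hlam₂ (WithLp.toLp 2 v)
  have h0 : Matrix.toEuclideanLin (matM σ₀ σ x lam₂) (WithLp.toLp 2 v) = 0 := by
    rw [Matrix.toLpLin_apply]
    exact congrArg (WithLp.toLp 2) hv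
  rw [h0] at h
  set p : EuclideanSpace ℝ (Fin L) := WithLp.toLp 2 v with hp
  have h1 : (0 : ℝ) = 1 / lam₂ * ‖(measH σ₀ σ x).adjoint p‖ ^ 2 + ‖p‖ ^ 2 := by
    have := congrArg (fun q => ⟪p, q⟫_ℝ) h
    simp only [inner_zero_right, inner_add_right, real_inner_smul_right,
      real_inner_self_eq_norm_sq] at this
    rwa [← ContinuousLinearMap.adjoint_inner_left, real_inner_self_eq_norm_sq] at this
  have h2 : 0 ≤ 1 / lam₂ * ‖(measH σ₀ σ x).adjoint p‖ ^ 2 := by positivity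
  have h3 : ‖p‖ ^ 2 = 0 := le_antisymm (by linarith) (by positivity)
  rw [sq_eq_zero_iff, norm_eq_zero] at h3
  exact congrArg WithLp.ofLp h3

/-- The smooth component of a minimizer. -/
theorem snd_eq_of_mem_solutionSet (hlam₂ : 0 < lam₂)
    {s : RadonMeasure d × GaussianRKHS d σ₀} (hs : s ∈ solutionSet σ₀ σ x lam₁ lam₂ y) :
    s.2 = (1 / lam₂) • (measH σ₀ σ x).adjoint
      (Matrix.toEuclideanLin (matM σ₀ σ x lam₂)⁻¹ (y - measB σ x s.1)) := by
  have h := smul_snd_eq_adjoint_residual x y hlam₂ hs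
  set r := y - (measB σ x s.1 + measH σ₀ σ x s.2) with hr
  have h1 : Matrix.toEuclideanLin (matM σ₀ σ x lam₂) r = y - measB σ x s.1 := by
    rw [toEuclideanLin_matM x hlam₂, ← h, map_smul, smul_smul, one_div_mul_cancel hlam₂.ne',
      one_smul, hr]
    abel
  have h2 : Matrix.toEuclideanLin (matM σ₀ σ x lam₂)⁻¹ (y - measB σ x s.1) = r := by
    rw [← h1, Matrix.toLpLin_apply, Matrix.toLpLin_apply, Matrix.mulVec_mulVec,
      Matrix.nonsing_inv_mul _ (isUnit_det_matM x hlam₂), Matrix.one_mulVec]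
  rw [h2, ← h, smul_smul, one_div_mul_cancel hlam₂.ne', one_smul]

end Smooth

/-! ### The sparse component of extreme points -/

section Sparse

variable {d L : ℕ}

/-- A signed measure whose variation has finite support is a combination of Dirac masses. -/
lemma eq_sum_diracMass (m : RadonMeasure d) (S : Finset (EuclideanSpace ℝ (Fin d)))
    (hS : m.variation (S : Set (EuclideanSpace ℝ (Fin d)))ᶜ = 0) :
    m = ∑ z ∈ S, m {z} • diracMass z := by
  classical
  ext E hE
  have h0 : m (E \ S) = 0 := by
    have h := m.enorm_measure_le_variation (E \ S)
    rw [measure_mono_null (fun z hz => hz.2) hS] at h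
    exact enorm_eq_zero.1 (le_antisymm h zero_le)
  have h1 : m (E ∩ S) = ∑ z ∈ S with z ∈ E, m {z} := by
    rw [← VectorMeasure.of_biUnion_finset]
    · congr 1
      ext z
      simp [and_comm]
    · exact fun a _ b _ hab => by simpa using hab
    · exact fun z _ => measurableSet_singleton z
  have h2 : m E = m (E ∩ S) + m (E \ S) := by
    rw [← VectorMeasure.of_union (disjoint_sdiff_inter.symm) (hE.inter S.measurableSet)
      (hE.diff S.measurableSet), inter_union_sdiff]
  rw [h2, h0, add_zero, h1, Finset.sum_filter]
  rw [FunLike.coe_sum, Finset.sum_apply]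
  refine Finset.sum_congr rfl fun z _ => ?_
  rw [smul_apply, diracMass, Measure.toSignedMeasure_apply_measurable hE,
    measureReal_def, Measure.dirac_apply' _ hE]
  by_cases hz : z ∈ E <;> simp [hz]

/-- Finitely many points of the support of a measure have disjoint neighbourhoods of positive
measure. -/
lemma exists_disjoint_of_mem_support {n : ℕ} (μ : Measure (EuclideanSpace ℝ (Fin d)))
    (p : Fin n → EuclideanSpace ℝ (Fin d)) (hp : Function.Injective p)
    (hs : ∀ i, p i ∈ μ.support) :
    ∃ A : Fin n → Set (EuclideanSpace ℝ (Fin d)), (∀ i, MeasurableSet (A i)) ∧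
      Pairwise (fun i j => Disjoint (A i) (A j)) ∧ ∀ i, 0 < μ (A i) := by
  obtain ⟨U, hU, hd⟩ := (Set.finite_range p).t2_separation
  refine ⟨fun i => U (p i), fun i => (hU _).2.measurableSet, fun i j hij => ?_, fun i => ?_⟩
  · exact hd (mem_range_self i) (mem_range_self j) (hp.ne hij)
  · exact (Measure.mem_support_iff_forall (p i)).1 (hs i) _ ((hU _).2.mem_nhds (hU _).1)

/-- Reweighting a signed measure on disjoint sets. -/
lemma tvNorm_add_sum_smul_restrict_le {n : ℕ} (m : RadonMeasure d)
    (A : Fin n → Set (EuclideanSpace ℝ (Fin d))) (hA : ∀ i, MeasurableSet (A i))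
    (hd : Pairwise (fun i j => Disjoint (A i) (A j))) (c : Fin n → ℝ) (hc : ∀ i, -1 ≤ c i) :
    tvNorm (m + ∑ i, c i • m.restrict (A i)) ≤ tvNorm m + ∑ i, c i * m.variation.real (A i) := by
  have hU : MeasurableSet (⋃ i, A i) := MeasurableSet.iUnion hA
  have hm : m = ∑ i, m.restrict (A i) + m.restrict (⋃ i, A i)ᶜ := by
    ext E hE
    rw [add_apply, FunLike.coe_sum, Finset.sum_apply,
      VectorMeasure.restrict_apply _ hU.compl hE]
    simp only [VectorMeasure.restrict_apply _ (hA _) hE]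
    rw [← tsum_fintype (L := .unconditional _) (fun i => m (E ∩ A i)), ← VectorMeasure.of_disjoint_iUnion
      (fun i => hE.inter (hA i)) fun i j hij => (hd hij).mono inter_subset_right inter_subset_right,
      ← inter_iUnion, ← VectorMeasure.of_union (disjoint_compl_right.mono inter_subset_right
        inter_subset_right) (hE.inter hU) (hE.inter hU.compl), inter_union_compl]
  -- The weights 1 + c i are nonnegative, so the norm of each piece is linear in c i.
  have he : m + ∑ i, c i • m.restrict (A i) =
      ∑ i, (1 + c i) • m.restrict (A i) + m.restrict (⋃ i, A i)ᶜ := by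
    simp only [add_smul, one_smul, Finset.sum_add_distrib]
    nth_rw 1 [hm]
    abel
  have hv : tvNorm m = ∑ i, m.variation.real (A i) + m.variation.real (⋃ i, A i)ᶜ := by
    rw [tvNorm_eq_variation, ← measureReal_iUnion_fintype hd hA,
      measureReal_add_measureReal_compl hU]
  rw [he, hv]
  refine (tvNorm_add_le _ _).trans ?_
  have h2 := tvNorm_sum_le Finset.univ fun i => (1 + c i) • m.restrict (A i)
  have h3 (i) : tvNorm ((1 + c i) • m.restrict (A i)) =
      m.variation.real (A i) + c i * m.variation.real (A i) := by
    rw [tvNorm_smul, tvNorm_restrict m (hA i), abs_of_nonneg (by linarith [hc i])]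
    ring
  simp only [h3, Finset.sum_add_distrib] at h2
  rw [tvNorm_restrict m hU.compl]
  linarith

/-- On subsets of A j only the j-th term survives; were the sum zero with c j ≠ 0, m would vanish on
all of them. -/
lemma sum_smul_restrict_ne_zero {n : ℕ} (m : RadonMeasure d)
    (A : Fin n → Set (EuclideanSpace ℝ (Fin d))) (hA : ∀ i, MeasurableSet (A i))
    (hd : Pairwise (fun i j => Disjoint (A i) (A j))) (hpos : ∀ i, 0 < m.variation (A i))
    {c : Fin n → ℝ} (hc : c ≠ 0) : ∑ i, c i • m.restrict (A i) ≠ 0 := by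
  obtain ⟨j, hj⟩ := Function.ne_iff.1 hc
  intro h
  refine (hpos j).ne' ((VectorMeasure.variation_apply_eq_zero (hA j)).2 fun E hE hEm => ?_)
  have h1 : (∑ i, c i • m.restrict (A i)) E = ∑ i, (c i • m.restrict (A i)) E := by
    rw [FunLike.coe_sum, Finset.sum_apply]
  rw [h, Finset.sum_eq_single j, smul_apply, VectorMeasure.restrict_apply _ (hA j) hEm,
    inter_eq_left.2 hE] at h1
  · exact (smul_eq_zero.1 h1.symm).resolve_left hj
  · intro i _ hij
    rw [smul_apply, VectorMeasure.restrict_apply _ (hA i) hEm,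
      ((hd hij).symm.mono_left hE).inter_eq, VectorMeasure.empty, smul_zero]
  · simp

variable {σ₀ σ lam₁ lam₂ : ℝ} (x : Fin L → EuclideanSpace ℝ (Fin d))
  (y : EuclideanSpace ℝ (Fin L))

/-- The variation of the sparse component of an extreme minimizer cannot charge more than `L`
disjoint sets. -/
theorem not_exists_disjoint_of_mem_extremePoints (hσ : 0 < σ) (hlam₁ : 0 < lam₁)
    {s : RadonMeasure d × GaussianRKHS d σ₀}
    (hs : s ∈ (solutionSet σ₀ σ x lam₁ lam₂ y).extremePoints ℝ)
    (A : Fin (L + 1) → Set (EuclideanSpace ℝ (Fin d))) (hA : ∀ i, MeasurableSet (A i))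
    (hd : Pairwise (fun i j => Disjoint (A i) (A j))) (hpos : ∀ i, 0 < s.1.variation (A i)) :
    False := by
  have hdep : ¬ LinearIndependent ℝ fun i => measBLin hσ x (s.1.restrict (A i)) := fun h => by
    simpa using h.fintype_card_le_finrank
  rw [Fintype.not_linearIndependent_iff] at hdep
  obtain ⟨b, hb, j, hj⟩ := hdep
  -- The dependence is divided by its sup norm, so that both c and -c are admissible reweightings.
  obtain ⟨c, hc0, hc1, hcB⟩ : ∃ c : Fin (L + 1) → ℝ, c ≠ 0 ∧ (∀ i, |c i| ≤ 1) ∧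
      measB σ x (∑ i, c i • s.1.restrict (A i)) = 0 := by
    have hb0 : b ≠ 0 := Function.ne_iff.2 ⟨j, hj⟩
    have hn : ‖b‖ ≠ 0 := norm_ne_zero_iff.2 hb0
    refine ⟨‖b‖⁻¹ • b, smul_ne_zero (inv_ne_zero hn) hb0, fun i => ?_, ?_⟩
    · have := norm_le_pi_norm (‖b‖⁻¹ • b) i
      rwa [norm_smul, norm_inv, norm_norm, inv_mul_cancel₀ hn] at this
    · change measBLin hσ x _ = 0
      simp only [map_sum, map_smul, Pi.smul_apply, smul_eq_mul, mul_smul, ← Finset.smul_sum, hb,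
        smul_zero]
  set τ := ∑ i, c i • s.1.restrict (A i) with hτ
  set D := ∑ i, c i * s.1.variation.real (A i) with hD
  have hplus : tvNorm (s.1 + τ) ≤ tvNorm s.1 + D :=
    tvNorm_add_sum_smul_restrict_le s.1 A hA hd c fun i => (abs_le.1 (hc1 i)).1
  have hminus : tvNorm (s.1 + (-1 : ℝ) • τ) ≤ tvNorm s.1 - D := by
    have h := tvNorm_add_sum_smul_restrict_le s.1 A hA hd (fun i => -c i)
      fun i => neg_le_neg (abs_le.1 (hc1 i)).2
    have e1 : ∑ i, (-c i) • s.1.restrict (A i) = (-1 : ℝ) • τ := by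
      simp only [hτ, Finset.smul_sum, smul_smul, neg_one_mul]
    have e2 : ∑ i, -c i * s.1.variation.real (A i) = -D := by
      simp only [hD, neg_mul, Finset.sum_neg_distrib]
    rwa [e1, e2, ← sub_eq_add_neg] at h
  have hobj (e : ℝ) : objective σ₀ σ x lam₁ lam₂ y (s.1 + e • τ, s.2) =
      objective σ₀ σ x lam₁ lam₂ y s + lam₁ * (tvNorm (s.1 + e • τ) - tvNorm s.1) := by
    simp only [objective, measB_add hσ, measB_smul hσ, hcB, smul_zero, add_zero]
    ring
  have hsol := hs.1
  -- Along τ only the total-variation term varies. With e = ±1 this forces D = 0, and both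
  -- perturbations remain minimizers.
  have hge (e : ℝ) : tvNorm s.1 ≤ tvNorm (s.1 + e • τ) := by
    have h := hsol (s.1 + e • τ, s.2)
    rw [hobj] at h
    nlinarith
  have h1 := hge 1
  have h2 := hge (-1)
  rw [one_smul] at h1
  have hmem (e : ℝ) (he : tvNorm (s.1 + e • τ) ≤ tvNorm s.1) :
      (s.1 + e • τ, s.2) ∈ solutionSet σ₀ σ x lam₁ lam₂ y := fun u => by
    refine le_trans ?_ (hsol u)
    rw [hobj]
    nlinarith
  have hm1 := hmem 1 (by rw [one_smul]; linarith)
  have hm2 := hmem (-1) (by linarith)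
  have heq := hs.2 hm1 hm2 ⟨1 / 2, 1 / 2, by norm_num, by norm_num, by norm_num, by
    ext1
    · simp only [Prod.fst_add, Prod.smul_fst]
      module
    · simp only [Prod.snd_add, Prod.smul_snd]
      module⟩
  have h0 : τ = 0 := by
    have := congrArg Prod.fst heq
    simpa using this
  exact sum_smul_restrict_ne_zero s.1 A hA hd hpos hc0 h0

/-- The sparse component of an extreme minimizer is a combination of at most `L` Dirac masses. -/
theorem fst_eq_sum_diracMass_of_mem_extremePoints (hσ : 0 < σ) (hlam₁ : 0 < lam₁)
    {s : RadonMeasure d × GaussianRKHS d σ₀}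
    (hs : s ∈ (solutionSet σ₀ σ x lam₁ lam₂ y).extremePoints ℝ) :
    ∃ K₀ : ℕ, K₀ ≤ L ∧ ∃ (a : Fin K₀ → ℝ) (z : Fin K₀ → EuclideanSpace ℝ (Fin d)),
      s.1 = ∑ k, a k • diracMass (z k) := by
  have hcard : s.1.variation.support.encard ≤ L := by
    by_contra! h
    have h' : ((L + 1 : ℕ) : ℕ∞) ≤ s.1.variation.support.encard := by
      simpa using Order.add_one_le_of_lt h
    obtain ⟨T, hT, hTc⟩ := exists_subset_encard_eq h'
    have hfin : T.Finite := finite_of_encard_eq_coe hTc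
    have hTn : hfin.toFinset.card = L + 1 := by
      rw [hfin.encard_eq_coe_toFinset_card] at hTc
      exact_mod_cast hTc
    let e := hfin.toFinset.equivFinOfCardEq hTn
    obtain ⟨A, hA, hd, hpos⟩ := exists_disjoint_of_mem_support s.1.variation
      (fun i => (e.symm i : EuclideanSpace ℝ (Fin d)))
      (Subtype.val_injective.comp e.symm.injective)
      (fun i => hT (hfin.mem_toFinset.1 (e.symm i).2))
    exact not_exists_disjoint_of_mem_extremePoints x y hσ hlam₁ hs A hA hd hpos
  have hfin : s.1.variation.support.Finite := finite_of_encard_le_coe hcard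
  -- The complement of the support of the variation is a null set.
  have hsum := eq_sum_diracMass s.1 hfin.toFinset (by simp)
  refine ⟨hfin.toFinset.card, ?_, fun k => s.1 {(hfin.toFinset.equivFin.symm k).1},
    fun k => (hfin.toFinset.equivFin.symm k).1, ?_⟩
  · rw [hfin.encard_eq_coe_toFinset_card] at hcard
    exact_mod_cast hcard
  · rw [hfin.toFinset.equivFin.symm.sum_comp fun z => s.1 {z.1} • diracMass z.1,
      Finset.sum_coe_sort hfin.toFinset fun z => s.1 {z} • diracMass z]
    exact hsum

end Sparse

end SparseSmooth

end

theorem mainTheorem3 (d L : ℕ) (hd : 1 ≤ d) (σ₀ σ lam₁ lam₂ : ℝ)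
    (hσ₀ : 0 < σ₀) (hσ : 0 < σ) (hlam₁ : 0 < lam₁) (hlam₂ : 0 < lam₂)
    (x : Fin L → EuclideanSpace ℝ (Fin d)) (y : EuclideanSpace ℝ (Fin L)) :
    (SparseSmooth.solutionSet σ₀ σ x lam₁ lam₂ y).Nonempty ∧
    Convex ℝ (SparseSmooth.solutionSet σ₀ σ x lam₁ lam₂ y) ∧
    SparseSmooth.IsWeakStarCompact (SparseSmooth.solutionSet σ₀ σ x lam₁ lam₂ y) ∧
    ∃ w : EuclideanSpace ℝ (Fin L),
      (∀ s ∈ SparseSmooth.solutionSet σ₀ σ x lam₁ lam₂ y, SparseSmooth.measB σ x s.1 = w) ∧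
      ∀ s ∈ (SparseSmooth.solutionSet σ₀ σ x lam₁ lam₂ y).extremePoints ℝ,
        (∃ K₀ : ℕ, K₀ ≤ L ∧ ∃ (a : Fin K₀ → ℝ) (z : Fin K₀ → EuclideanSpace ℝ (Fin d)),
          s.1 = ∑ k, a k • SparseSmooth.diracMass (z k)) ∧
        s.2 = (1 / lam₂) • (SparseSmooth.measH σ₀ σ x).adjoint
          (Matrix.toEuclideanLin (SparseSmooth.matM σ₀ σ x lam₂)⁻¹ (y - w)) := by
  obtain ⟨s₀, hs₀⟩ := SparseSmooth.nonempty_solutionSet (σ₀ := σ₀) x y hσ hlam₁ hlam₂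
  refine ⟨⟨s₀, hs₀⟩, SparseSmooth.convex_solutionSet x y hσ hlam₁ hlam₂,
    SparseSmooth.isWeakStarCompact_solutionSet x y hσ hlam₁ hlam₂, SparseSmooth.measB σ x s₀.1,
    fun s hs => SparseSmooth.measB_eq_of_mem_solutionSet x y hσ hlam₁ hlam₂ hs hs₀,
    fun s hs => ⟨SparseSmooth.fst_eq_sum_diracMass_of_mem_extremePoints x y hσ hlam₁ hs, ?_⟩⟩
  rw [← SparseSmooth.measB_eq_of_mem_solutionSet x y hσ hlam₁ hlam₂ hs.1 hs₀]
  exact SparseSmooth.snd_eq_of_mem_solutionSet x y hlam₂ hs.1
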